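/- Write $\mathbb{G}(n,d/n)$ for the Erdős–Rényi random graph on the vertex set $[n]=\{1,\dots,n\}$, in which each of the $\binom n2$ possible edges is present independently with probability $d/n$ (here $d>0$ is real). For a positive integer $d$ and $n$ with $nd$ even, write $\mathbb{G}_d(n)$ for a graph chosen uniformly at random among all simple $d$-regular graphs on $[n]$. For a graph $G$ and integers $0\le k\le m$, let $\mathcal{O}(G,m,k)$ denote the set of pairs $(I,J)$ of independent sets of $G$ with $|I|=|J|=m$ and $|I\cap J|=k$. **Theorem 2.6.** Let $\beta\in(1/\sqrt2,1)$ and $0<z<\sqrt{2\beta^2-1}$. For $d>1$ put $s=(1+\beta)\frac{\log d}{d}$, and let $K_n(z)$ be the set of integers $k$ with $$(1-z)\frac{n\log d}{d}\le k\le(1+z)\frac{n\log d}{d}.$$ Then there is a $d_0=d_0(\beta,z)$ such that the following hold. 1. For every real $d\ge d_0$, $$\lim_{n\to\infty}\mathbb{P}\Big(\bigcup_{k\in K_n(z)}\mathcal{O}\big(\mathbb{G}(n,d/n),\lfloor sn\rfloor,k\big)\neq\emptyset\Big)=0 .$$ 2. For every integer $d\ge d_0$, $$\lim_{\substack{n\to\infty\\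 nd\text{ even}}}\mathbb{P}\Big(\bigcup_{k\in K_n(z)}\mathcal{O}\big(\mathbb{G}_d(n),\lfloor sn\rfloor,k\big)\neq\emptyset\Big)=0 .$$ -/

import Mathlib

open Filter Topology MeasureTheory ProbabilityTheory

namespace RandomGraphOverlap

/-- The edge probability `d / n` as a point of the unit interval. It is truncated to `[0, 1]`, which
only matters for the finitely many `n < d` (when `d ≥ 0`). -/
noncomputable def edgeProb (d : ℝ) (n : ℕ) : unitInterval :=
  Set.projIcc 0 1 zero_le_one (d / n)

/-- The law of the Erdős–Rényi random graph `𝔾(n, d/n)` on the vertex set `Fin n`: each of the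
`n.choose 2` edges is present independently with probability `d / n`. -/
noncomputable def erdosRenyi (n : ℕ) (d : ℝ) : Measure (SimpleGraph (Fin n)) :=
  SimpleGraph.binomialRandom (Fin n) (edgeProb d n)

open Classical in
/-- The set of all (simple, labelled) `d`-regular graphs on the vertex set `Fin n`. -/
def regularGraphs (n d : ℕ) : Set (SimpleGraph (Fin n)) :=
  {G | G.IsRegularOfDegree d}

/-- The law of the random regular graph `𝔾_d(n)`: the uniform distribution on the set of all
`d`-regular graphs on `Fin n`. -/
noncomputable def randomRegular (n d : ℕ) : Measure (SimpleGraph (Fin n)) :=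
  uniformOn (regularGraphs n d)

/-- The set of ordered pairs `(I, J)` of independent sets of `G`, both of cardinality `m`, with
`|I ∩ J| = k`. -/
def overlap {n : ℕ} (G : SimpleGraph (Fin n)) (m k : ℕ) : Set (Finset (Fin n) × Finset (Fin n)) :=
  {P | G.IsNIndepSet m P.1 ∧ G.IsNIndepSet m P.2 ∧ (P.1 ∩ P.2).card = k}

/-- The integers `k` with `(1 - z) n log d / d ≤ k ≤ (1 + z) n log d / d`. (Natural numbers suffice:
intersection sizes are nonnegative.) -/
def forbidden (z d : ℝ) (n : ℕ) : Set ℕ :=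
  {k | (1 - z) * n * Real.log d / d ≤ (k : ℝ) ∧ (k : ℝ) ≤ (1 + z) * n * Real.log d / d}

/-- The normalised size `s = (1 + β) log d / d`. -/
noncomputable def density (β d : ℝ) : ℝ := (1 + β) * Real.log d / d

/-- The event that `G` has two independent sets of size `⌊s n⌋` whose intersection size lies in the
forbidden range. -/
def overlapEvent (β z d : ℝ) (n : ℕ) : Set (SimpleGraph (Fin n)) :=
  {G | (⋃ k ∈ forbidden z d n, overlap G ⌊density β d * n⌋₊ k).Nonempty}

end RandomGraphOverlap

/-! The proof is a first-moment bound. Put ℓ = log d, M = nℓ/d, m ≈ (1+β)M and k = (1+x)M with |x| ≤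
z. There are at most exp((2m-k)ℓ + 3n/d) pairs of m-sets meeting in k points
(`card_pairsWith_le_exp`), and b = m(m-1) - k(k-1)/2 vertex pairs lie inside I or J
(`two_mul_card_insidePairs`). If all of them are non-edges with probability about exp(-bd/n), the
expected number of pairs has exponent ℓM times 2(1+β) - (1+x) - (1+β)² + (1+x)²/2 = 1/2 - β² + x²/2
≤ -c, where c = β² - 1/2 - z²/2. The terms linear in x cancel, and z < √(2β²-1) says exactly that c
> 0. For large d the term 3n/d = 3M/ℓ is negligible, and so is a factor 1 - c/8 lost in front of
bd/n (`exponent_le`); a union bound finishes (`tendsto_overlapEvent`).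

In 𝔾(n, d/n) the probability is bounded by independence. In 𝔾_d(n) switchings are used: delete ux,
vy, ab and insert uv, xa, yb, where uv is a pair in A and a, b lie away from the vertices W that A
touches. Counting them from both sides shows that the numbers f(t) of regular graphs with t edges in
A satisfy f(t)·l ≤ f(t+1)·(t+1) with l = (1-ε)|A|d/n (`card_regularWith_mul_le`). So f grows at
least like lᵗ/t! up to t ≈ l, which makes f(0) smaller than the total by e^{-l} up to a factor
linear in l (`head_le_of_ratio`). -/

namespace RandomGraphOverlap

open Finset

/-! ### Switchings that create one edge in a prescribed set -/

section SwitchDefs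

variable {V : Type*} {A E : Finset (Sym2 V)} {W : Finset V} {u v x y a b : V}

/-- The data of a switching: an ordered pair `(u, v)` that is to be joined, neighbours `x` of `u` and
`y` of `v`, and an ordered edge `(a, b)`. -/
abbrev SwitchData (V : Type*) := (V × V) × (V × V) × (V × V)

/-- The switchings of `E` that create exactly one edge in `A`, where the edges in `A` have their
endpoints in `W`. -/
structure IsSwitch (A : Finset (Sym2 V)) (W : Finset V) (E : Finset (Sym2 V)) (u v x y a b : V) :
    Prop where
  uv_mem : s(u, v) ∈ A
  uv_notMem : s(u, v) ∉ E
  ux_mem : s(u, x) ∈ E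
  ux_notMem : s(u, x) ∉ A
  vy_mem : s(v, y) ∈ E
  vy_notMem : s(v, y) ∉ A
  ab_mem : s(a, b) ∈ E
  a_notMem : a ∉ W
  b_notMem : b ∉ W
  a_ne : a ≠ x
  xa_notMem : s(x, a) ∉ E
  b_ne : b ≠ y
  yb_notMem : s(y, b) ∉ E

namespace IsSwitch

lemma u_mem (h : IsSwitch A W E u v x y a b) (hW : ∀ e ∈ A, ∀ w ∈ e, w ∈ W) : u ∈ W :=
  hW _ h.uv_mem u (by simp)

lemma v_mem (h : IsSwitch A W E u v x y a b) (hW : ∀ e ∈ A, ∀ w ∈ e, w ∈ W) : v ∈ W :=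
  hW _ h.uv_mem v (by simp)

/-- Together with `added_distinct`, this lets degrees be counted edge by edge: `removed` and `added`
are sets, so coinciding edges would be lost. -/
lemma removed_distinct (h : IsSwitch A W E u v x y a b) (hA : ∀ e ∈ A, ¬ e.IsDiag)
    (hW : ∀ e ∈ A, ∀ w ∈ e, w ∈ W) :
    s(u, x) ≠ s(v, y) ∧ s(u, x) ≠ s(a, b) ∧ s(v, y) ≠ s(a, b) := by
  have huv : u ≠ v := by simpa using hA _ h.uv_mem
  have hu := h.u_mem hW
  have hv := h.v_mem hW
  have ha := h.a_notMem
  have hb := h.b_notMem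
  have h1 := h.uv_notMem
  have h2 := h.ux_mem
  simp only [ne_eq, Sym2.eq_iff]
  refine ⟨?_, ?_, ?_⟩
  · rintro (⟨h, -⟩ | ⟨rfl, rfl⟩)
    · exact huv h
    · exact h1 h2
  · rintro (⟨rfl, -⟩ | ⟨rfl, -⟩)
    · exact ha hu
    · exact hb hu
  · rintro (⟨rfl, -⟩ | ⟨rfl, -⟩)
    · exact ha hv
    · exact hb hv

lemma added_distinct (h : IsSwitch A W E u v x y a b) (hE : ∀ e ∈ E, ¬ e.IsDiag)
    (hW : ∀ e ∈ A, ∀ w ∈ e, w ∈ W) :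
    s(u, v) ≠ s(x, a) ∧ s(u, v) ≠ s(y, b) ∧ s(x, a) ≠ s(y, b) := by
  have hab : a ≠ b := by simpa using hE _ h.ab_mem
  have hu := h.u_mem hW
  have hv := h.v_mem hW
  have ha := h.a_notMem
  have hb := h.b_notMem
  have h1 := h.xa_notMem
  have h2 := h.ab_mem
  simp only [ne_eq, Sym2.eq_iff]
  refine ⟨?_, ?_, ?_⟩
  · rintro (⟨-, rfl⟩ | ⟨rfl, -⟩)
    · exact ha hv
    · exact ha hu
  · rintro (⟨-, rfl⟩ | ⟨rfl, -⟩)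
    · exact hb hv
    · exact hb hu
  · rintro (⟨-, h⟩ | ⟨rfl, rfl⟩)
    · exact hab h
    · exact h1 (by rwa [Sym2.eq_swap])

end IsSwitch

variable [DecidableEq V]

/-- The edges removed by a switching. -/
def removed (τ : SwitchData V) : Finset (Sym2 V) :=
  {s(τ.1.1, τ.2.1.1), s(τ.1.2, τ.2.1.2), s(τ.2.2.1, τ.2.2.2)}

/-- The edges added by a switching. -/
def added (τ : SwitchData V) : Finset (Sym2 V) :=
  {s(τ.1.1, τ.1.2), s(τ.2.1.1, τ.2.2.1), s(τ.2.1.2, τ.2.2.2)}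

/-- The edge set obtained by a switching. -/
def switch (E : Finset (Sym2 V)) (τ : SwitchData V) : Finset (Sym2 V) := (E \ removed τ) ∪ added τ

namespace IsSwitch

lemma removed_subset (h : IsSwitch A W E u v x y a b) : removed ((u, v), (x, y), (a, b)) ⊆ E := by
  simp [removed, insert_subset_iff, h.ux_mem, h.vy_mem, h.ab_mem]

lemma disjoint_added (h : IsSwitch A W E u v x y a b) :
    Disjoint E (added ((u, v), (x, y), (a, b))) := by
  simp [added, h.uv_notMem, h.xa_notMem, h.yb_notMem]

/-- A switching can be undone. -/
lemma undo (h : IsSwitch A W E u v x y a b) :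
    (switch E ((u, v), (x, y), (a, b)) \ added ((u, v), (x, y), (a, b))) ∪
      removed ((u, v), (x, y), (a, b)) = E := by
  have h1 := h.removed_subset
  have h2 := h.disjoint_added
  rw [switch, union_sdiff_right, sdiff_eq_self_of_disjoint (h2.mono_left sdiff_subset),
    sdiff_union_of_subset h1]

/-- Every altered edge meeting `a` or `b` leaves `W`, hence is not in `A`, and the other two deleted
edges avoid `A` by assumption; only `uv` counts. -/
lemma card_switch_inter (h : IsSwitch A W E u v x y a b) (hW : ∀ e ∈ A, ∀ w ∈ e, w ∈ W) :
    #(switch E ((u, v), (x, y), (a, b)) ∩ A) = #(E ∩ A) + 1 := by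
  have : switch E ((u, v), (x, y), (a, b)) ∩ A = insert s(u, v) (E ∩ A) := by
    have ha := h.a_notMem
    have hb := h.b_notMem
    have hab : s(a, b) ∉ A := fun h => ha (hW _ h a (by simp))
    have hxa : s(x, a) ∉ A := fun h => ha (hW _ h a (by simp))
    have hyb : s(y, b) ∉ A := fun h => hb (hW _ h b (by simp))
    have h1 := h.uv_mem
    have h2 := h.ux_notMem
    have h3 := h.vy_notMem
    ext e
    simp only [switch, removed, added, mem_inter, mem_union, Finset.mem_sdiff, mem_insert, mem_singleton]
    constructor
    · rintro ⟨he | rfl | rfl | rfl, h'⟩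
      · exact Or.inr ⟨he.1, h'⟩
      · exact Or.inl rfl
      · exact absurd h' hxa
      · exact absurd h' hyb
    · rintro (rfl | ⟨h4, h5⟩)
      · exact ⟨Or.inr (Or.inl rfl), h1⟩
      · refine ⟨Or.inl ⟨h4, ?_⟩, h5⟩
        rintro (rfl | rfl | rfl)
        · exact h2 h5
        · exact h3 h5
        · exact hab h5
  rw [this, card_insert_of_notMem (by simp [h.uv_notMem])]

end IsSwitch

end SwitchDefs

/-! ### Degrees, and regularity under switching -/

section Switching

variable {V : Type*} [Fintype V] [DecidableEq V]

/-- The ordered pairs of vertices that span an element of `A`. -/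
def darts (A : Finset (Sym2 V)) : Finset (V × V) := {p | s(p.1, p.2) ∈ A}

/-- The neighbours of `v` along the edges in `E`. -/
def nbrs (E : Finset (Sym2 V)) (v : V) : Finset V := {x | s(v, x) ∈ E}

@[simp] lemma mem_darts {A : Finset (Sym2 V)} {p : V × V} : p ∈ darts A ↔ s(p.1, p.2) ∈ A := by
  simp [darts]

@[simp] lemma mem_nbrs {E : Finset (Sym2 V)} {v x : V} : x ∈ nbrs E v ↔ s(v, x) ∈ E := by
  simp [nbrs]

lemma card_darts {A : Finset (Sym2 V)} (hA : ∀ e ∈ A, ¬ e.IsDiag) : #(darts A) = 2 * #A := by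
  rw [card_eq_sum_card_fiberwise (f := fun p : V × V => s(p.1, p.2)) (t := A)
    (fun p hp => by simpa using hp)]
  rw [sum_const_nat (m := 2), mul_comm]
  intro e he
  induction e with | _ a b
  have hab : a ≠ b := by simpa using hA _ he
  rw [show ({p ∈ darts A | s(p.1, p.2) = s(a, b)} : Finset (V × V)) = {(a, b), (b, a)} by
    ext ⟨x, y⟩
    simp only [mem_filter, mem_darts, Sym2.eq_iff, mem_insert, mem_singleton, Prod.mk.injEq]
    constructor
    · rintro ⟨-, h⟩
      exact h
    · rintro (⟨rfl, rfl⟩ | ⟨rfl, rfl⟩)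
      · exact ⟨he, by simp⟩
      · exact ⟨by rwa [Sym2.eq_swap], by simp⟩]
  exact card_pair (by simp [hab])

lemma card_darts_eq_sum (A : Finset (Sym2 V)) : #(darts A) = ∑ v, #(nbrs A v) := by
  rw [card_eq_sum_card_fiberwise (f := Prod.fst) (t := univ) (fun p _ => by simp)]
  refine sum_congr rfl fun v _ => ?_
  refine card_bij' (fun p _ => p.2) (fun x _ => (v, x)) ?_ ?_ ?_ ?_
  · rintro ⟨a, b⟩ h
    simp only [mem_filter, mem_darts] at h
    obtain ⟨h, rfl⟩ := h
    simpa using h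
  · intro x hx
    simpa using hx
  · rintro ⟨a, b⟩ h
    simp only [mem_filter, mem_darts] at h
    obtain ⟨h, rfl⟩ := h
    rfl
  · intro x hx
    rfl

/-- The edge sets of the `d`-regular graphs on `V`. -/
def regularEdgeSets (V : Type*) [Fintype V] [DecidableEq V] (d : ℕ) : Finset (Finset (Sym2 V)) :=
  {E | (∀ e ∈ E, ¬ e.IsDiag) ∧ ∀ v, #{e ∈ E | v ∈ e} = d}

variable {d : ℕ} {E : Finset (Sym2 V)}

lemma mem_regularEdgeSets :
    E ∈ regularEdgeSets V d ↔ (∀ e ∈ E, ¬ e.IsDiag) ∧ ∀ v, #{e ∈ E | v ∈ e} = d := by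
  simp [regularEdgeSets]

lemma card_nbrs_eq (v : V) : #(nbrs E v) = #{e ∈ E | v ∈ e} := by
  refine card_bij (fun x _ => s(v, x)) ?_ ?_ ?_
  · intro x hx
    simpa using hx
  · intro x _ y _ h
    exact Sym2.congr_right.1 h
  · intro e he
    obtain ⟨he, x, rfl⟩ := by simpa only [mem_filter] using he
    exact ⟨x, by simpa using he, rfl⟩

lemma card_nbrs (hE : E ∈ regularEdgeSets V d) (v : V) : #(nbrs E v) = d := by
  rw [card_nbrs_eq]
  exact (mem_regularEdgeSets.1 hE).2 v

lemma card_darts_regular (hE : E ∈ regularEdgeSets V d) : #(darts E) = Fintype.card V * d := by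
  rw [card_darts_eq_sum, sum_congr rfl fun v _ => card_nbrs hE v]
  simp

variable {A : Finset (Sym2 V)} {W : Finset V} {u v x y a b : V}

namespace IsSwitch

/-- The three deleted and the three inserted edges have the same multiset of endpoints u, v, x, y,
a, b, so no degree changes. -/
lemma switch_mem (h : IsSwitch A W E u v x y a b) (hA : ∀ e ∈ A, ¬ e.IsDiag)
    (hW : ∀ e ∈ A, ∀ w ∈ e, w ∈ W) (hE : E ∈ regularEdgeSets V d) :
    switch E ((u, v), (x, y), (a, b)) ∈ regularEdgeSets V d := by
  obtain ⟨hE, hd⟩ := mem_regularEdgeSets.1 hE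
  have huv : u ≠ v := by simpa using hA _ h.uv_mem
  refine mem_regularEdgeSets.2 ⟨?_, fun w => ?_⟩
  · intro e he
    simp only [switch, added, mem_union, Finset.mem_sdiff, mem_insert, mem_singleton] at he
    rcases he with he | rfl | rfl | rfl
    · exact hE e he.1
    · exact hA _ h.uv_mem
    · simpa using h.a_ne.symm
    · simpa using h.b_ne.symm
  · obtain ⟨r1, r2, r3⟩ := h.removed_distinct hA hW
    obtain ⟨a1, a2, a3⟩ := h.added_distinct hE hW
    have hux : u ≠ x := by simpa using hE _ h.ux_mem
    have hvy : v ≠ y := by simpa using hE _ h.vy_mem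
    have hab : a ≠ b := by simpa using hE _ h.ab_mem
    have hxa := h.a_ne
    have hyb := h.b_ne
    have hsub : ({e ∈ removed ((u, v), (x, y), (a, b)) | w ∈ e} : Finset (Sym2 V)) ⊆
        {e ∈ E | w ∈ e} := filter_subset_filter _ h.removed_subset
    have hdisj : Disjoint
        (({e ∈ E | w ∈ e} : Finset (Sym2 V)) \ {e ∈ removed ((u, v), (x, y), (a, b)) | w ∈ e})
        ({e ∈ added ((u, v), (x, y), (a, b)) | w ∈ e} : Finset (Sym2 V)) :=
      h.disjoint_added.mono (sdiff_subset.trans (filter_subset _ _)) (filter_subset _ _)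
    have hcard : #({e ∈ removed ((u, v), (x, y), (a, b)) | w ∈ e} : Finset (Sym2 V)) =
        #({e ∈ added ((u, v), (x, y), (a, b)) | w ∈ e} : Finset (Sym2 V)) := by
      rw [card_filter, card_filter, removed, added, sum_insert, sum_insert, sum_singleton,
        sum_insert, sum_insert, sum_singleton]
      · simp only [Sym2.mem_iff]
        have key : ∀ p q : V, p ≠ q → (if w = p ∨ w = q then 1 else 0) =
            (if w = p then 1 else 0) + (if w = q then 1 else 0) := by
          intro p q hpq
          by_cases h1 : w = p <;> by_cases h2 : w = q <;> simp_all
        rw [key _ _ hux, key _ _ hvy, key _ _ hab, key _ _ huv, key _ _ hxa.symm, key _ _ hyb.symm]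
        ring
      · simpa only [mem_singleton] using a3
      · simpa only [mem_insert, mem_singleton, not_or] using ⟨a1, a2⟩
      · simpa only [mem_singleton] using r3
      · simpa only [mem_insert, mem_singleton, not_or] using ⟨r1, r2⟩
    have hle := card_le_card hsub
    rw [switch, filter_union, show ({e ∈ E \ removed ((u, v), (x, y), (a, b)) | w ∈ e} :
        Finset (Sym2 V)) = {e ∈ E | w ∈ e} \ {e ∈ removed ((u, v), (x, y), (a, b)) | w ∈ e} by
      ext e; simp only [mem_filter, Finset.mem_sdiff]; tauto, card_union_of_disjoint hdisj, card_sdiff_of_subset hsub]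
    rw [← hd w]
    omega

end IsSwitch

end Switching

/-! ### Double counting of switchings -/

section SwitchCount

variable {V : Type*} [Fintype V] [DecidableEq V] {d : ℕ} {A E : Finset (Sym2 V)} {W : Finset V}

lemma card_darts_fst (E : Finset (Sym2 V)) (S : Finset V) :
    #{p ∈ darts E | p.1 ∈ S} = ∑ v ∈ S, #(nbrs E v) := by
  rw [← card_sigma]
  refine card_bij' (fun p _ => ⟨p.1, p.2⟩) (fun p _ => (p.1, p.2)) ?_ ?_ ?_ ?_ <;>
  simp +contextual

lemma card_darts_snd (E : Finset (Sym2 V)) (S : Finset V) :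
    #{p ∈ darts E | p.2 ∈ S} = #{p ∈ darts E | p.1 ∈ S} := by
  refine card_bij' (fun p _ => p.swap) (fun p _ => p.swap) ?_ ?_ ?_ ?_ <;>
  simp +contextual [Sym2.eq_swap]

/-- The possible third edges of a switching. -/
def thirdEdges (W : Finset V) (E : Finset (Sym2 V)) (x y : V) : Finset (V × V) :=
  {p ∈ darts E | p.1 ∉ W ∪ insert x (nbrs E x) ∧ p.2 ∉ W ∪ insert y (nbrs E y)}

/-- Each end of the dart must avoid at most #W + d + 1 vertices, and each vertex starts and ends
only `d` darts. -/
lemma le_card_thirdEdges (hE : E ∈ regularEdgeSets V d) (x y : V) :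
    Fintype.card V * d ≤ #(thirdEdges W E x y) + 2 * ((#W + (d + 1)) * d) := by
  have hS (x : V) : #{p ∈ darts E | p.1 ∈ W ∪ insert x (nbrs E x)} ≤ (#W + (d + 1)) * d := by
    rw [card_darts_fst, sum_congr rfl fun v _ => card_nbrs hE v, sum_const, smul_eq_mul]
    refine Nat.mul_le_mul_right _ ((card_union_le _ _).trans (Nat.add_le_add_left ?_ _))
    exact (card_insert_le _ _).trans (by rw [card_nbrs hE])
  have hsub : darts E ⊆ thirdEdges W E x y ∪ ({p ∈ darts E | p.1 ∈ W ∪ insert x (nbrs E x)} ∪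
      {p ∈ darts E | p.2 ∈ W ∪ insert y (nbrs E y)}) := by
    intro p hp
    simp only [thirdEdges, Finset.mem_union, mem_filter,
      hp, true_and]
    tauto
  have h1 := (card_le_card hsub).trans
    ((card_union_le _ _).trans (Nat.add_le_add_left (card_union_le _ _) _))
  rw [card_darts_regular hE, card_darts_snd] at h1
  have := hS x
  have := hS y
  omega

/-- Counts the choices of u, v, x, y. With g(v) the degree of v in `E ∩ A`, the summand is (d -
g(u))(d - g(v)) ≥ d² - d·g(u) - d·g(v), and summing g(u) over `W × W` costs at most #W · 2#(E ∩ A).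
-/
lemma le_sum_card_nbrs_mul (hE : E ∈ regularEdgeSets V d) (hA : ∀ e ∈ A, ¬ e.IsDiag)
    (hW : ∀ e ∈ A, ∀ w ∈ e, w ∈ W) :
    2 * ((#A : ℝ) - #(E ∩ A)) * d ^ 2 - 4 * #(E ∩ A) * #W * d ≤
      ∑ p ∈ darts (A \ E), (#(nbrs (E \ A) p.1) : ℝ) * #(nbrs (E \ A) p.2) := by
  have hg (v : V) : (#(nbrs (E \ A) v) : ℝ) = d - #(nbrs (E ∩ A) v) := by
    have h1 : nbrs E v = nbrs (E \ A) v ∪ nbrs (E ∩ A) v := by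
      ext x
      simp only [Finset.mem_union, mem_nbrs, Finset.mem_sdiff, Finset.mem_inter]
      tauto
    have h2 : Disjoint (nbrs (E \ A) v) (nbrs (E ∩ A) v) := by
      refine disjoint_left.2 fun x hx hx' => ?_
      simp only [mem_nbrs, Finset.mem_sdiff, Finset.mem_inter] at hx hx'
      exact hx.2 hx'.2
    have h3 := card_nbrs hE v
    rw [h1, card_union_of_disjoint h2] at h3
    rw [← h3]
    push_cast
    ring
  have hsumg : ∑ v, (#(nbrs (E ∩ A) v) : ℝ) = 2 * #(E ∩ A) := by
    have h := card_darts_eq_sum (E ∩ A)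
    rw [card_darts fun e he => hA e (Finset.mem_inter.1 he).2] at h
    exact_mod_cast h.symm
  have hsub : darts (A \ E) ⊆ W ×ˢ W := by
    rintro ⟨u, v⟩ hp
    simp only [mem_darts, Finset.mem_sdiff] at hp
    exact mem_product.2 ⟨hW _ hp.1 u (by simp), hW _ hp.1 v (by simp)⟩
  have hle : ∑ v ∈ W, (#(nbrs (E ∩ A) v) : ℝ) ≤ 2 * #(E ∩ A) := by
    rw [← hsumg]
    exact sum_le_sum_of_subset_of_nonneg (subset_univ _) fun _ _ _ => by positivity
  have h1 : ∑ p ∈ darts (A \ E), (#(nbrs (E ∩ A) p.1) : ℝ) ≤ #W * (2 * #(E ∩ A)) := by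
    refine (sum_le_sum_of_subset_of_nonneg hsub fun _ _ _ => by positivity).trans ?_
    rw [sum_product_right]
    simp only [sum_const, nsmul_eq_mul]
    gcongr
  have h2 : ∑ p ∈ darts (A \ E), (#(nbrs (E ∩ A) p.2) : ℝ) ≤ #W * (2 * #(E ∩ A)) := by
    refine (sum_le_sum_of_subset_of_nonneg hsub fun _ _ _ => by positivity).trans ?_
    rw [sum_product]
    simp only [sum_const, nsmul_eq_mul]
    gcongr
  have hcard : (#(darts (A \ E)) : ℝ) = 2 * ((#A : ℝ) - #(E ∩ A)) := by
    rw [card_darts fun e he => hA e (Finset.mem_sdiff.1 he).1]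
    have := card_sdiff_add_card_inter A E
    rw [inter_comm] at this
    rw [← this]
    push_cast
    ring
  calc 2 * ((#A : ℝ) - #(E ∩ A)) * d ^ 2 - 4 * #(E ∩ A) * #W * d
      ≤ #(darts (A \ E)) * (d : ℝ) ^ 2 - d * ∑ p ∈ darts (A \ E), (#(nbrs (E ∩ A) p.1) : ℝ)
        - d * ∑ p ∈ darts (A \ E), (#(nbrs (E ∩ A) p.2) : ℝ) := by
        rw [hcard]
        have hd : (0 : ℝ) ≤ d := by positivity
        nlinarith [mul_le_mul_of_nonneg_left h1 hd, mul_le_mul_of_nonneg_left h2 hd]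
    _ = ∑ p ∈ darts (A \ E), ((d : ℝ) ^ 2 - d * #(nbrs (E ∩ A) p.1) - d * #(nbrs (E ∩ A) p.2)) := by
        simp only [sum_sub_distrib, mul_sum, sum_const, nsmul_eq_mul]
    _ ≤ _ := by
        refine sum_le_sum fun p _ => ?_
        rw [hg, hg]
        have : (0 : ℝ) ≤ (#(nbrs (E ∩ A) p.1) : ℝ) * #(nbrs (E ∩ A) p.2) := by positivity
        nlinarith

/-- The switchings of `E` that create exactly one edge in `A`. -/
def switchings (A : Finset (Sym2 V)) (W : Finset V) (E : Finset (Sym2 V)) :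
    Finset (Σ _ : V × V, Σ _ : V × V, V × V) :=
  (darts (A \ E)).sigma fun p =>
    (nbrs (E \ A) p.1 ×ˢ nbrs (E \ A) p.2).sigma fun q => thirdEdges W E q.1 q.2

lemma isSwitch_of_mem {τ : Σ _ : V × V, Σ _ : V × V, V × V} (hτ : τ ∈ switchings A W E) :
    IsSwitch A W E τ.1.1 τ.1.2 τ.2.1.1 τ.2.1.2 τ.2.2.1 τ.2.2.2 := by
  simp only [switchings, mem_sigma, mem_darts, Finset.mem_sdiff, mem_product, mem_nbrs, thirdEdges,
    mem_filter, Finset.mem_union, mem_insert, not_or] at hτ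
  obtain ⟨⟨h1, h2⟩, ⟨⟨h3, h4⟩, h5, h6⟩, h7, ⟨h8, h9, h10⟩, h11, h12, h13⟩ := hτ
  exact ⟨h1, h2, h3, h4, h5, h6, h7, h8, h11, h9, h10, h12, h13⟩

lemma le_card_switchings (hE : E ∈ regularEdgeSets V d) (hA : ∀ e ∈ A, ¬ e.IsDiag)
    (hW : ∀ e ∈ A, ∀ w ∈ e, w ∈ W)
    (hN : 0 ≤ (Fintype.card V * d : ℝ) - 2 * ((#W + (d + 1)) * d)) :
    (2 * ((#A : ℝ) - #(E ∩ A)) * d ^ 2 - 4 * #(E ∩ A) * #W * d) *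
      (Fintype.card V * d - 2 * ((#W + (d + 1)) * d)) ≤ #(switchings A W E) := by
  refine (mul_le_mul_of_nonneg_right (le_sum_card_nbrs_mul hE hA hW) hN).trans ?_
  rw [switchings, card_sigma, Nat.cast_sum, sum_mul]
  refine sum_le_sum fun p _ => ?_
  rw [card_sigma, Nat.cast_sum, ← Nat.cast_mul, ← card_product, ← nsmul_eq_mul]
  refine card_nsmul_le_sum _ _ _ fun q _ => ?_
  have := le_card_thirdEdges (W := W) hE q.1 q.2
  rw [sub_le_iff_le_add]
  exact_mod_cast this

/-- The `d`-regular edge sets with exactly `t` elements in `A`. -/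
def regularWith (A : Finset (Sym2 V)) (d t : ℕ) : Finset (Finset (Sym2 V)) :=
  {E ∈ regularEdgeSets V d | #(E ∩ A) = t}

/-- By `IsSwitch.undo`, a switching is determined by its result and the three inserted darts. The
dart `uv` lies in `A`, which leaves 2(t+1) choices; each of the others is one of at most nd darts.
-/
lemma sum_card_switchings_le (hA : ∀ e ∈ A, ¬ e.IsDiag) (hW : ∀ e ∈ A, ∀ w ∈ e, w ∈ W) (t : ℕ) :
    ∑ E ∈ regularWith A d t, #(switchings A W E) ≤
      #(regularWith A d (t + 1)) * (2 * (t + 1) * (Fintype.card V * d) ^ 2) := by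
  have hrhs : #((regularWith A d (t + 1)).sigma fun E =>
      darts (E ∩ A) ×ˢ darts E ×ˢ darts E) =
      #(regularWith A d (t + 1)) * (2 * (t + 1) * (Fintype.card V * d) ^ 2) := by
    rw [card_sigma, sum_const_nat]
    intro E hE
    obtain ⟨hE, ht⟩ := mem_filter.1 hE
    rw [card_product, card_product, card_darts fun e he => hA e (Finset.mem_inter.1 he).2,
      card_darts_regular hE, ht, sq]
  rw [← hrhs, ← card_sigma]
  -- The entries are regrouped from (x, y), (a, b) into the inserted darts (x, a), (y, b).
  refine card_le_card_of_injOn (fun σ => ⟨switch σ.1 (σ.2.1, σ.2.2.1, σ.2.2.2),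
    σ.2.1, (σ.2.2.1.1, σ.2.2.2.1), (σ.2.2.1.2, σ.2.2.2.2)⟩) ?_ ?_
  · rintro ⟨E, p, q, r⟩ h
    obtain ⟨hE, hτ⟩ := mem_sigma.1 (mem_coe.1 h)
    obtain ⟨hE, ht⟩ := mem_filter.1 hE
    have hs := isSwitch_of_mem hτ
    refine mem_coe.2 (mem_sigma.2 ⟨mem_filter.2 ⟨hs.switch_mem hA hW hE, ?_⟩, ?_⟩)
    · rw [← ht]
      exact hs.card_switch_inter hW
    · have := hs.uv_mem
      simp only [mem_product, mem_darts, Finset.mem_inter, switch, added, Finset.mem_union,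
        mem_insert, mem_singleton]
      tauto
  · rintro ⟨E, p, q, r⟩ h ⟨E', p', q', r'⟩ h' heq
    obtain ⟨hE, hτ⟩ := mem_sigma.1 (mem_coe.1 h)
    obtain ⟨hE', hτ'⟩ := mem_sigma.1 (mem_coe.1 h')
    have hu := (isSwitch_of_mem hτ).undo
    have hu' := (isSwitch_of_mem hτ').undo
    obtain ⟨q1, q2⟩ := q
    obtain ⟨r1, r2⟩ := r
    obtain ⟨q1', q2'⟩ := q'
    obtain ⟨r1', r2'⟩ := r'
    simp only [Sigma.mk.injEq, heq_eq_eq, Prod.mk.injEq] at heq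
    obtain ⟨h1, rfl, ⟨rfl, rfl⟩, rfl, rfl⟩ := heq
    have : E = E' := hu.symm.trans ((congrArg (fun F => (F \ _) ∪ _) h1).trans hu')
    rw [this]

end SwitchCount

/-! ### From ratios to an exponentially small first term -/

lemma factorial_mul_exp_le {T : ℕ} (hT : 1 ≤ T) :
    (T.factorial : ℝ) * Real.exp T ≤ Real.exp 1 * T * (T : ℝ) ^ T := by
  induction T, hT using Nat.le_induction with
  | base => simp
  | succ T hT ih =>
    have hT0 : (0 : ℝ) < T := by exact_mod_cast hT
    have hT1 : (0 : ℝ) < T + 1 := by positivity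
    -- This is log(1 + 1/T) ≥ 1/(T+1), multiplied by T + 1 and exponentiated.
    have h1 : Real.exp 1 * (T : ℝ) ^ (T + 1) ≤ ((T : ℝ) + 1) ^ (T + 1) := by
      have h2 : 1 / ((T : ℝ) + 1) ≤ Real.log (((T : ℝ) + 1) / T) := by
        refine le_trans (le_of_eq ?_) (Real.one_sub_inv_le_log_of_pos (by positivity))
        field_simp
        ring
      have h3 : Real.exp 1 ≤ (((T : ℝ) + 1) / T) ^ (T + 1) := by
        rw [← Real.exp_log (show 0 < ((T : ℝ) + 1) / T by positivity), ← Real.exp_nat_mul,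
          Real.exp_le_exp]
        push_cast
        calc (1 : ℝ) = (T + 1) * (1 / (T + 1)) := by field_simp
          _ ≤ _ := by gcongr
      calc Real.exp 1 * (T : ℝ) ^ (T + 1) ≤ (((T : ℝ) + 1) / T) ^ (T + 1) * (T : ℝ) ^ (T + 1) := by
            gcongr
        _ = _ := by rw [← mul_pow, div_mul_cancel₀ _ hT0.ne']
    rw [Nat.factorial_succ]
    push_cast
    rw [Real.exp_add]
    calc ((T : ℝ) + 1) * T.factorial * (Real.exp T * Real.exp 1)
        = (T + 1) * Real.exp 1 * (T.factorial * Real.exp T) := by ring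
      _ ≤ (T + 1) * Real.exp 1 * (Real.exp 1 * T * (T : ℝ) ^ T) := by gcongr
      _ = (T + 1) * Real.exp 1 * (Real.exp 1 * (T : ℝ) ^ (T + 1)) := by ring
      _ ≤ (T + 1) * Real.exp 1 * ((T : ℝ) + 1) ^ (T + 1) := by gcongr
      _ = _ := by ring

/-- A nonnegative sequence whose ratios are at least those of `l ^ t / t!` starts with a term that is
exponentially small in `l`. -/
lemma head_le_of_ratio {f : ℕ → ℝ} {l M : ℝ} (hl : 0 ≤ l) (hM : ∀ t, f t ≤ M) (hf0 : 0 ≤ f 0)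
    (hf : ∀ t : ℕ, (t : ℝ) ≤ l → f t * l ≤ f (t + 1) * (t + 1)) :
    f 0 ≤ Real.exp 2 * (1 + l) * Real.exp (-l) * M := by
  have hpow (T : ℕ) (hT : (T : ℝ) ≤ l) : f 0 * l ^ T ≤ T.factorial * f T := by
    induction T with
    | zero => simp
    | succ T ih =>
      push_cast at hT
      have hT' : (T : ℝ) ≤ l := by linarith
      have h1 := mul_le_mul_of_nonneg_right (ih hT') hl
      have h2 := mul_le_mul_of_nonneg_left (hf T hT') (Nat.cast_nonneg' (α := ℝ) T.factorial)
      rw [Nat.factorial_succ]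
      push_cast
      rw [pow_succ]
      linarith
  have hM0 : 0 ≤ M := hf0.trans (hM 0)
  have hfl := Nat.floor_le hl
  have hlt := Nat.lt_floor_add_one l
  set T := ⌊l⌋₊ with hTdef
  -- The ratios are followed up to T = ⌊l⌋, where lᵀ/T! is largest. If T = 0, the claimed factor is
  -- already at least 1.
  rcases Nat.eq_zero_or_pos T with h0 | hpos
  · have hl1 : l < 1 := by simpa [h0] using hlt
    have h1 : 1 ≤ Real.exp 2 * (1 + l) * Real.exp (-l) := by
      have : Real.exp 2 * (1 + l) * Real.exp (-l) = Real.exp (2 - l) * (1 + l) := by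
        rw [sub_eq_add_neg, Real.exp_add]
        ring
      rw [this]
      exact one_le_mul_of_one_le_of_one_le (Real.one_le_exp (by linarith)) (by linarith)
    exact (hM 0).trans (le_mul_of_one_le_left hM0 h1)
  · have hT0 : (0 : ℝ) < T := by exact_mod_cast hpos
    have hl0 : 0 < l := hT0.trans_le hfl
    have h1 := hpow T hfl
    have h2 := factorial_mul_exp_le hpos
    have h3 : (T : ℝ) ^ T ≤ l ^ T := by gcongr
    have hlT : 0 < l ^ T := by positivity
    have h4 : f 0 * Real.exp T ≤ Real.exp 1 * T * M := by
      refine le_of_mul_le_mul_right ?_ hlT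
      calc f 0 * Real.exp T * l ^ T = f 0 * l ^ T * Real.exp T := by ring
        _ ≤ T.factorial * f T * Real.exp T := by gcongr
        _ ≤ T.factorial * M * Real.exp T := by
          gcongr
          exact hM T
        _ = T.factorial * Real.exp T * M := by ring
        _ ≤ Real.exp 1 * T * (T : ℝ) ^ T * M := by gcongr
        _ ≤ Real.exp 1 * T * l ^ T * M := by gcongr
        _ = _ := by ring
    have h5 : f 0 ≤ Real.exp 1 * T * M * Real.exp (-T) := by
      rw [Real.exp_neg, ← div_eq_mul_inv, le_div_iff₀ (Real.exp_pos _)]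
      exact h4
    -- Replacing T by l - 1 in the exponent costs the second factor e.
    calc f 0 ≤ Real.exp 1 * T * M * Real.exp (-T) := h5
      _ ≤ Real.exp 1 * (1 + l) * M * Real.exp (1 - l) := by
        gcongr
        · linarith
        · linarith
      _ = _ := by
        rw [sub_eq_add_neg, Real.exp_add, show (2 : ℝ) = 1 + 1 by norm_num, Real.exp_add]
        ring

/-! ### Regular graphs with no edge in a prescribed set -/

section SwitchBound

variable {V : Type*} [Fintype V] [DecidableEq V] {d : ℕ} {A : Finset (Sym2 V)} {W : Finset V}

/-- Divides the lower bound on switchings out of level t by the upper bound on those into level t +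
1. -/
lemma card_regularWith_mul_le (hA : ∀ e ∈ A, ¬ e.IsDiag) (hW : ∀ e ∈ A, ∀ w ∈ e, w ∈ W)
    (hd : 0 < d) {ε : ℝ} (hε1 : ε ≤ 1) (hV : 0 < Fintype.card V)
    (h : 4 * (#W : ℝ) + 3 * d + 2 ≤ ε * Fintype.card V) {t : ℕ}
    (ht : (t : ℝ) ≤ #A * d / Fintype.card V) :
    (#(regularWith A d t) : ℝ) * ((1 - ε) * (#A * d / Fintype.card V)) ≤
      #(regularWith A d (t + 1)) * (t + 1) := by
  set N : ℝ := (Fintype.card V : ℝ) with hN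
  have hN0 : 0 < N := by rw [hN]; exact_mod_cast hV
  have hd0 : (0 : ℝ) < d := by exact_mod_cast hd
  set w : ℝ := (#W : ℝ)
  set α : ℝ := (#A : ℝ)
  have hw0 : 0 ≤ w := by positivity
  have hα0 : 0 ≤ α := by positivity
  have ht' : (t : ℝ) * N ≤ α * d := by rwa [le_div_iff₀ hN0] at ht
  have hεN : ε * N ≤ N := by nlinarith
  have hY : N * d - 2 * ((w + (d + 1)) * d) = d * (N - 2 * (w + d + 1)) := by ring
  have hY0 : 0 ≤ N - 2 * (w + d + 1) := by linarith
  have h1 : (#(regularWith A d t) : ℝ) * ((2 * (α - t) * d ^ 2 - 4 * t * w * d) *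
      (N * d - 2 * ((w + (d + 1)) * d))) ≤
      #(regularWith A d (t + 1)) * (2 * (t + 1) * (N * d) ^ 2) := by
    have hsum := sum_card_switchings_le (d := d) hA hW t
    have hcast : (∑ E ∈ regularWith A d t, (#(switchings A W E) : ℝ)) ≤
        #(regularWith A d (t + 1)) * (2 * (t + 1) * (N * d) ^ 2) := by
      rw [hN]
      exact_mod_cast hsum
    refine le_trans ?_ hcast
    rw [← nsmul_eq_mul]
    refine card_nsmul_le_sum _ _ _ fun E hE => ?_
    obtain ⟨hE, hEt⟩ := mem_filter.1 hE
    have := le_card_switchings hE hA hW (by rw [hY]; positivity)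
    rwa [hEt] at this
  have h2 : (1 - ε) * (α * d / N) * (2 * (N * d) ^ 2) ≤
      (2 * (α - t) * d ^ 2 - 4 * t * w * d) * (N * d - 2 * ((w + (d + 1)) * d)) := by
    have e1 : (1 - ε) * (α * d / N) * (2 * (N * d) ^ 2) =
        2 * α * d ^ 3 * (N - ε * N) := by
      field_simp
    -- Since tN ≤ αd, the terms containing t lose only a fraction (d + 2w)/N of the main term 2αd².
    have e2 : 2 * α * d ^ 2 * (N - d - 2 * w) ≤ N * (2 * (α - t) * d ^ 2 - 4 * t * w * d) := by
      have : N * (2 * (α - t) * d ^ 2 - 4 * t * w * d) =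
        2 * α * d ^ 2 * N - (t * N) * (2 * d ^ 2 + 4 * w * d) := by ring
      rw [this]
      have : t * N * (2 * d ^ 2 + 4 * w * d) ≤ α * d * (2 * d ^ 2 + 4 * w * d) := by gcongr
      linarith
    -- The two relative losses (d + 2w)/N and 2(w + d + 1)/N add up to (4w + 3d + 2)/N ≤ ε.
    have e3 : N * (N - ε * N) ≤ (N - d - 2 * w) * (N - 2 * (w + d + 1)) := by
      have : 0 ≤ (d + 2 * w) * (2 * (w + d + 1)) := by positivity
      nlinarith
    rw [e1, hY]
    refine le_of_mul_le_mul_left ?_ hN0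
    calc N * (2 * α * d ^ 3 * (N - ε * N)) = 2 * α * d ^ 3 * (N * (N - ε * N)) := by ring
      _ ≤ 2 * α * d ^ 3 * ((N - d - 2 * w) * (N - 2 * (w + d + 1))) := by gcongr
      _ = 2 * α * d ^ 2 * (N - d - 2 * w) * (d * (N - 2 * (w + d + 1))) := by ring
      _ ≤ N * (2 * (α - t) * d ^ 2 - 4 * t * w * d) * (d * (N - 2 * (w + d + 1))) := by gcongr
      _ = _ := by ring
  have hpos : 0 < 2 * (N * d) ^ 2 := by positivity
  refine le_of_mul_le_mul_right ?_ hpos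
  calc (#(regularWith A d t) : ℝ) * ((1 - ε) * (α * d / N)) * (2 * (N * d) ^ 2)
      = (#(regularWith A d t) : ℝ) * ((1 - ε) * (α * d / N) * (2 * (N * d) ^ 2)) := by ring
    _ ≤ (#(regularWith A d t) : ℝ) * ((2 * (α - t) * d ^ 2 - 4 * t * w * d) *
        (N * d - 2 * ((w + (d + 1)) * d))) := by gcongr
    _ ≤ _ := h1
    _ = _ := by ring

/-- The proportion of `d`-regular graphs without edges in `A`. -/
lemma card_regularWith_zero_le (hA : ∀ e ∈ A, ¬ e.IsDiag) (hW : ∀ e ∈ A, ∀ w ∈ e, w ∈ W)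
    (hd : 0 < d) {ε : ℝ} (hε0 : 0 ≤ ε) (hε1 : ε ≤ 1) (hV : 0 < Fintype.card V)
    (h : 4 * (#W : ℝ) + 3 * d + 2 ≤ ε * Fintype.card V) :
    (#(regularWith A d 0) : ℝ) ≤
      Real.exp 2 * (1 + (1 - ε) * (#A * d / Fintype.card V)) *
        Real.exp (-((1 - ε) * (#A * d / Fintype.card V))) * #(regularEdgeSets V d) := by
  have h0 : 0 ≤ (#A : ℝ) * d / Fintype.card V := by positivity
  refine head_le_of_ratio (f := fun t => (#(regularWith A d t) : ℝ))
    (mul_nonneg (by linarith) h0) (fun t => ?_) (by positivity) fun t ht => ?_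
  · exact_mod_cast card_le_card (filter_subset _ _)
  · exact card_regularWith_mul_le hA hW hd hε1 hV h (ht.trans (by nlinarith))

end SwitchBound

/-! ### Avoidance probabilities in the two models -/

/-- The set of graphs without an edge in `A`. -/
def avoiding {n : ℕ} (A : Finset (Sym2 (Fin n))) : Set (SimpleGraph (Fin n)) :=
  {G | ∀ e ∈ A, e ∉ G.edgeSet}

lemma erdosRenyi_avoiding_le {n : ℕ} {d : ℝ} (hd : 0 ≤ d) (hdn : d ≤ n)
    {A : Finset (Sym2 (Fin n))} (hA : ∀ e ∈ A, ¬ e.IsDiag) :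
    erdosRenyi n d (avoiding A) ≤ ENNReal.ofReal (Real.exp (-(#A * d / n))) := by
  have hp : ((edgeProb d n : unitInterval) : ℝ) = d / n := by
    rw [edgeProb, Set.projIcc_of_mem]
    exact ⟨by positivity, div_le_one_of_le₀ hdn (Nat.cast_nonneg _)⟩
  rw [erdosRenyi, SimpleGraph.binomialRandom_apply]
  refine (measure_mono (t := Set.pi A fun _ => {False}) ?_).trans ?_
  · rintro _ ⟨G, hG, rfl⟩ e he
    simpa using hG e he
  rw [Measure.infinitePi_pi _ fun _ _ => MeasurableSet.of_discrete]
  have : ∀ e ∈ A, ((unitInterval.toNNReal (edgeProb d n)) • Measure.dirac (¬ e.IsDiag) +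
      (unitInterval.toNNReal (unitInterval.symm (edgeProb d n))) • Measure.dirac False)
        ({False} : Set Prop) ≤ ENNReal.ofReal (Real.exp (-(d / n))) := by
    intro e he
    -- Off the diagonal this atom sits at `True`, so only the weight 1 - d/n remains, and 1 - p ≤
    -- exp(-p).
    have h1 : (Measure.dirac (¬ e.IsDiag) : Measure Prop) {False} = 0 := by
      simp [hA e he]
    rw [Measure.add_apply, Measure.smul_apply, Measure.smul_apply, h1]
    simp only [smul_zero, zero_add, Measure.dirac_apply_of_mem (Set.mem_singleton False)]
    rw [ENNReal.smul_def, smul_eq_mul, mul_one, ← ENNReal.ofReal_coe_nnreal]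
    refine ENNReal.ofReal_le_ofReal ?_
    rw [unitInterval.coe_toNNReal, unitInterval.coe_symm_eq, hp]
    linarith [Real.add_one_le_exp (-(d / n))]
  refine (Finset.prod_le_prod' this).trans ?_
  rw [prod_const, ← ENNReal.ofReal_pow (Real.exp_pos _).le, ← Real.exp_nat_mul]
  refine ENNReal.ofReal_le_ofReal (Real.exp_le_exp.2 (le_of_eq ?_))
  ring

instance {V : Type*} [Countable V] : MeasurableSingletonClass (SimpleGraph V) where
  measurableSet_singleton G := by
    rw [← SimpleGraph.edgeSet_injective.preimage_image {G}, Set.image_singleton]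
    exact SimpleGraph.measurable_edgeSet (measurableSet_singleton _)

open Classical in
lemma edgeFinset_mem_regularEdgeSets {n d : ℕ} {G : SimpleGraph (Fin n)} :
    G.edgeFinset ∈ regularEdgeSets (Fin n) d ↔ G ∈ regularGraphs n d := by
  rw [mem_regularEdgeSets]
  simp only [← SimpleGraph.incidenceFinset_eq_filter, SimpleGraph.card_incidenceFinset_eq_degree]
  constructor
  · rintro ⟨-, h⟩
    exact fun v => h v
  · intro h
    exact ⟨fun e he => G.not_isDiag_of_mem_edgeFinset he, fun v => h v⟩

-- No existence of regular graphs is needed: if there are none, `uniformOn` of the empty set is the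
-- zero measure.
open Classical in
lemma randomRegular_avoiding_le {n d : ℕ} {A : Finset (Sym2 (Fin n))} {c : ℝ} (hc : 0 ≤ c)
    (h : (#(regularWith A d 0) : ℝ) ≤ c * #(regularEdgeSets (Fin n) d)) :
    randomRegular n d (avoiding A) ≤ ENNReal.ofReal c := by
  have hs : regularGraphs n d = ((univ.filter (· ∈ regularGraphs n d) :
    Finset (SimpleGraph (Fin n))) : Set (SimpleGraph (Fin n))) := by simp
  have ht : avoiding A = ((univ.filter (· ∈ avoiding A) :
    Finset (SimpleGraph (Fin n))) : Set (SimpleGraph (Fin n))) := by simp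
  rw [randomRegular, hs, ht, uniformOn_apply_finset]
  refine ENNReal.div_le_of_le_mul ?_
  have h1 : #((univ.filter (· ∈ regularGraphs n d) : Finset (SimpleGraph (Fin n))) ∩
      (univ.filter (· ∈ avoiding A))) ≤ #(regularWith A d 0) := by
    refine card_le_card_of_injOn (fun G => G.edgeFinset) ?_
      (fun G _ G' _ h => SimpleGraph.edgeFinset_inj.1 h)
    intro G hG
    simp only [coe_inter, coe_filter, mem_univ, true_and, Set.mem_inter_iff, Set.mem_ofPred_eq]
      at hG
    refine mem_coe.2 (mem_filter.2 ⟨edgeFinset_mem_regularEdgeSets.2 hG.1, ?_⟩)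
    rw [card_eq_zero, eq_empty_iff_forall_notMem]
    intro e he
    obtain ⟨he, he'⟩ := Finset.mem_inter.1 he
    exact hG.2 e he' (SimpleGraph.mem_edgeFinset.1 he)
  have h2 : #(regularEdgeSets (Fin n) d) ≤
      #(univ.filter (· ∈ regularGraphs n d) : Finset (SimpleGraph (Fin n))) := by
    have hinv : ∀ E ∈ regularEdgeSets (Fin n) d,
        (SimpleGraph.fromEdgeSet (E : Set (Sym2 (Fin n)))).edgeSet = E := by
      intro E hE
      ext e
      rw [SimpleGraph.edgeSet_fromEdgeSet]
      refine ⟨fun h => h.1, fun h => ⟨h, (mem_regularEdgeSets.1 hE).1 e h⟩⟩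
    refine card_le_card_of_injOn
      (fun E => SimpleGraph.fromEdgeSet (E : Set (Sym2 (Fin n)))) ?_ ?_
    · intro E hE
      simp only [coe_filter, mem_univ, true_and, Set.mem_ofPred_eq]
      rw [← edgeFinset_mem_regularEdgeSets]
      convert mem_coe.1 hE
      rw [← coe_inj, SimpleGraph.coe_edgeFinset, hinv E hE]
    · intro E hE E' hE' h
      rw [← coe_inj, ← hinv E hE, ← hinv E' hE']
      exact congrArg SimpleGraph.edgeSet h
  have h3 : (#((univ.filter (· ∈ regularGraphs n d) : Finset (SimpleGraph (Fin n))) ∩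
      (univ.filter (· ∈ avoiding A))) : ℝ) ≤
      c * #(univ.filter (· ∈ regularGraphs n d) : Finset (SimpleGraph (Fin n))) := by
    calc _ ≤ (#(regularWith A d 0) : ℝ) := by exact_mod_cast h1
      _ ≤ _ := h
      _ ≤ _ := by gcongr
  rw [← ENNReal.ofReal_natCast, ← ENNReal.ofReal_natCast, ← ENNReal.ofReal_mul hc]
  exact ENNReal.ofReal_le_ofReal h3

/-! ### Pairs of sets with given overlap: inside pairs and enumeration -/

/-- The pairs of vertices that lie both in `I` or both in `J`. -/
def insidePairs {n : ℕ} (I J : Finset (Fin n)) : Finset (Sym2 (Fin n)) :=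
  I.offDiag.image Sym2.mk.uncurry ∪ J.offDiag.image Sym2.mk.uncurry

section InsidePairs

variable {n : ℕ} {I J : Finset (Fin n)}

lemma mk_mem_image_offDiag {u v : Fin n} :
    s(u, v) ∈ I.offDiag.image Sym2.mk.uncurry ↔ u ∈ I ∧ v ∈ I ∧ u ≠ v := by
  simp only [mem_image, mem_offDiag, Prod.exists, Function.uncurry_apply_pair, Sym2.eq_iff]
  constructor
  · rintro ⟨a, b, ⟨h1, h2, h3⟩, ⟨rfl, rfl⟩ | ⟨rfl, rfl⟩⟩
    · exact ⟨h1, h2, h3⟩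
    · exact ⟨h2, h1, h3.symm⟩
  · intro h
    exact ⟨u, v, h, Or.inl ⟨rfl, rfl⟩⟩

lemma mk_mem_insidePairs {u v : Fin n} :
    s(u, v) ∈ insidePairs I J ↔ (u ∈ I ∧ v ∈ I ∧ u ≠ v) ∨ (u ∈ J ∧ v ∈ J ∧ u ≠ v) := by
  rw [insidePairs, Finset.mem_union, mk_mem_image_offDiag, mk_mem_image_offDiag]

lemma not_isDiag_of_mem_insidePairs : ∀ e ∈ insidePairs I J, ¬ e.IsDiag := by
  intro e he
  induction e with | _ u v
  rw [mk_mem_insidePairs] at he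
  rw [Sym2.mk_isDiag_iff]
  tauto

lemma mem_union_of_mem_insidePairs : ∀ e ∈ insidePairs I J, ∀ w ∈ e, w ∈ I ∪ J := by
  intro e he w hw
  induction e with | _ u v
  rw [mk_mem_insidePairs] at he
  rw [Sym2.mem_iff] at hw
  rw [Finset.mem_union]
  rcases hw with rfl | rfl <;> tauto

/-- Inclusion-exclusion: a pair inside both sets is a pair inside `I ∩ J`. -/
lemma two_mul_card_insidePairs {m k : ℕ} (hI : #I = m) (hJ : #J = m) (hk : #(I ∩ J) = k) :
    2 * (#(insidePairs I J) : ℝ) = 2 * (m * (m - 1)) - k * (k - 1) := by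
  have hinter : I.offDiag.image Sym2.mk.uncurry ∩ J.offDiag.image Sym2.mk.uncurry =
      (I ∩ J).offDiag.image Sym2.mk.uncurry := by
    ext e
    induction e with | _ u v
    rw [Finset.mem_inter, mk_mem_image_offDiag, mk_mem_image_offDiag, mk_mem_image_offDiag,
      Finset.mem_inter, Finset.mem_inter]
    tauto
  have h := card_union_add_card_inter (I.offDiag.image Sym2.mk.uncurry)
    (J.offDiag.image Sym2.mk.uncurry)
  rw [hinter, Sym2.card_image_offDiag, Sym2.card_image_offDiag, Sym2.card_image_offDiag, hI, hJ, hk]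
    at h
  have h' : (#(insidePairs I J) : ℝ) + (k.choose 2 : ℕ) = (m.choose 2 : ℕ) + (m.choose 2 : ℕ) := by
    exact_mod_cast h
  rw [Nat.cast_choose_two, Nat.cast_choose_two] at h'
  linarith

lemma mem_avoiding_insidePairs {G : SimpleGraph (Fin n)} (hI : G.IsIndepSet I)
    (hJ : G.IsIndepSet J) : G ∈ avoiding (insidePairs I J) := by
  intro e he
  induction e with | _ u v
  rw [SimpleGraph.mem_edgeSet]
  rcases mk_mem_insidePairs.1 he with ⟨h1, h2, h3⟩ | ⟨h1, h2, h3⟩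
  · exact hI h1 h2 h3
  · exact hJ h1 h2 h3

end InsidePairs

/-- A single term of the binomial expansion of (1 + 1/d)ⁿ ≤ exp(n/d). The loss exp(n/d) is of lower
order than the exponents of size n(log d)²/d. -/
lemma choose_le_pow_mul_exp {d : ℝ} (hd : 0 < d) (n k : ℕ) :
    (n.choose k : ℝ) ≤ d ^ k * Real.exp (n / d) := by
  have h1 : (n.choose k : ℝ) * (1 / d) ^ k ≤ Real.exp (n / d) := by
    rcases lt_or_ge n k with h | h
    · rw [Nat.choose_eq_zero_of_lt h]
      simp [(Real.exp_pos _).le]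
    calc (n.choose k : ℝ) * (1 / d) ^ k
        ≤ ∑ i ∈ range (n + 1), (1 / d) ^ i * 1 ^ (n - i) * (n.choose i : ℝ) := by
          refine le_trans (le_of_eq ?_) (single_le_sum
            (f := fun i => (1 / d) ^ i * 1 ^ (n - i) * (n.choose i : ℝ))
            (fun i _ => by positivity) (mem_range.2 (Nat.lt_succ_of_le h)))
          simp [mul_comm]
      _ = (1 / d + 1) ^ n := (add_pow _ _ _).symm
      _ ≤ Real.exp (1 / d) ^ n := by
          gcongr
          exact Real.add_one_le_exp _
      _ = Real.exp (n / d) := by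
          rw [← Real.exp_nat_mul]
          ring_nf
  calc (n.choose k : ℝ) = d ^ k * ((n.choose k : ℝ) * (1 / d) ^ k) := by
        rw [mul_left_comm, ← mul_pow, mul_one_div_cancel hd.ne', one_pow, mul_one]
    _ ≤ _ := by gcongr

/-- The pairs of sets of size `m` whose intersection has size `k`. -/
def pairsWith (n m k : ℕ) : Finset (Finset (Fin n) × Finset (Fin n)) :=
  {P | #P.1 = m ∧ #P.2 = m ∧ #(P.1 ∩ P.2) = k}

/-- The pair is recovered from `I ∩ J`, `I \ J` and `J \ I`. -/
lemma card_pairsWith_le (n m k : ℕ) :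
    #(pairsWith n m k) ≤ n.choose k * (n.choose (m - k) * n.choose (m - k)) := by
  have h : #(powersetCard k (univ : Finset (Fin n)) ×ˢ (powersetCard (m - k) (univ : Finset (Fin n))
      ×ˢ powersetCard (m - k) (univ : Finset (Fin n)))) =
      n.choose k * (n.choose (m - k) * n.choose (m - k)) := by
    simp
  rw [← h]
  refine card_le_card_of_injOn (fun P => (P.1 ∩ P.2, P.1 \ P.2, P.2 \ P.1)) ?_ ?_
  · intro P hP
    obtain ⟨-, h1, h2, h3⟩ := mem_filter.1 (mem_coe.1 hP)
    have e1 := card_inter_add_card_sdiff P.1 P.2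
    have e2 := card_inter_add_card_sdiff P.2 P.1
    rw [inter_comm] at e2
    simp only [coe_product, Set.mem_prod, mem_coe, mem_powersetCard_univ]
    omega
  · intro P _ Q _ h
    simp only [Prod.mk.injEq] at h
    obtain ⟨h1, h2, h3⟩ := h
    refine Prod.ext ?_ ?_
    · rw [← sdiff_union_inter P.1 P.2, h1, h2, sdiff_union_inter]
    · rw [← sdiff_union_inter P.2 P.1, inter_comm, h1, h3, inter_comm, sdiff_union_inter]

lemma card_pairsWith_le_exp {d : ℝ} (hd : 0 < d) {n m k : ℕ} (hk : k ≤ m) :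
    (#(pairsWith n m k) : ℝ) ≤ Real.exp ((2 * m - k) * Real.log d + 3 * n / d) := by
  have h : (#(pairsWith n m k) : ℝ) ≤
      n.choose k * (n.choose (m - k) * n.choose (m - k)) := by
    exact_mod_cast card_pairsWith_le n m k
  have hpow (j : ℕ) : d ^ j * Real.exp (n / d) = Real.exp (j * Real.log d + n / d) := by
    rw [Real.exp_add, Real.exp_nat_mul, Real.exp_log hd]
  refine h.trans ?_
  calc (n.choose k : ℝ) * (n.choose (m - k) * n.choose (m - k))
      ≤ (d ^ k * Real.exp (n / d)) *
        ((d ^ (m - k) * Real.exp (n / d)) * (d ^ (m - k) * Real.exp (n / d))) := by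
        gcongr <;> exact choose_le_pow_mul_exp hd _ _
    _ = _ := by
        rw [hpow, hpow, ← Real.exp_add, ← Real.exp_add]
        congr 1
        push_cast [hk]
        ring

/-! ### The first-moment argument -/

/-- The exponent of the first moment is negative of linear order. -/
lemma exponent_le {β z c d : ℝ} (hβ0 : 0 < β) (hβ1 : β < 1)
    (hc : c = β ^ 2 - 1 / 2 - z ^ 2 / 2) (hc0 : 0 < c) (hd : 1 < d)
    (hlog : 12 ≤ c * Real.log d ^ 2) {n m k : ℕ} (hm : m = ⌊density β d * n⌋₊)
    (hM : 1 ≤ n * Real.log d / d) (hk : k ∈ forbidden z d n) (hkm : k ≤ m) {b : ℝ}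
    (hb : 2 * b = 2 * (m * (m - 1)) - k * (k - 1)) :
    (2 * m - k) * Real.log d + 3 * n / d - (1 - c / 8) * (b * d / n) ≤
      6 * Real.log d - c / 4 * Real.log d ^ 2 / d * n := by
  have hd0 : 0 < d := by linarith
  have hℓ : 0 < Real.log d := Real.log_pos hd
  have hcle : c ≤ 1 := by nlinarith
  set ℓ := Real.log d
  have hn0 : (n : ℝ) ≠ 0 := by
    rintro h
    rw [h] at hM
    norm_num at hM
  obtain ⟨hk1, hk2⟩ := hk
  set M := n * ℓ / d with hMdef
  have hdens : density β d * n = (1 + β) * M := by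
    rw [density, hMdef]
    ring
  have hm1 : (m : ℝ) ≤ (1 + β) * M := by
    rw [hm, ← hdens]
    exact Nat.floor_le (by rw [hdens]; positivity)
  have hm2 : (1 + β) * M - 1 ≤ m := by
    rw [hm, ← hdens]
    exact (Nat.sub_one_lt_floor _).le
  have hk1' : (1 - z) * M ≤ k := by
    refine le_trans (le_of_eq ?_) hk1
    rw [hMdef]
    ring
  have hk2' : (k : ℝ) ≤ (1 + z) * M := by
    refine hk2.trans (le_of_eq ?_)
    rw [hMdef]
    ring
  have hM0 : 0 < M := by linarith
  have hdn : d / n = ℓ / M := by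
    rw [hMdef]
    field_simp
  have hnd : (n : ℝ) / d = M / ℓ := by
    rw [hMdef]
    field_simp
  have hkm' : (k : ℝ) ≤ m := by exact_mod_cast hkm
  have hk0 : (0 : ℝ) ≤ k := by positivity
  obtain ⟨x, hx⟩ : ∃ x : ℝ, (k : ℝ) = (1 + x) * M := ⟨k / M - 1, by field_simp; ring⟩
  have hx1 : -z ≤ x := by
    have : (1 - z) * M ≤ (1 + x) * M := by rwa [← hx]
    linarith [le_of_mul_le_mul_right this hM0]
  have hx2 : x ≤ z := by
    have : (1 + x) * M ≤ (1 + z) * M := by rwa [← hx]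
    linarith [le_of_mul_le_mul_right this hM0]
  have hxz : x ^ 2 ≤ z ^ 2 := sq_le_sq' hx1 hx2
  -- Rounding in m costs 2(1+β)M and the linear term of m(m-1) costs (1+β)M, together less than 6M.
  have hb1 : (1 + β) ^ 2 * M ^ 2 - 6 * M - k ^ 2 / 2 ≤ b := by
    have h1 : ((1 + β) * M - 1) ^ 2 ≤ (m : ℝ) ^ 2 := by
      refine pow_le_pow_left₀ ?_ hm2 2
      linarith [mul_nonneg hβ0.le hM0.le]
    have h2 : β * M ≤ 1 * M := by gcongr
    linarith
  have hb2 : b ≤ 4 * M ^ 2 := by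
    have h1 : (m : ℝ) ≤ 2 * M := hm1.trans (by gcongr; linarith)
    have h2 : (m : ℝ) ^ 2 ≤ (2 * M) ^ 2 := pow_le_pow_left₀ (by positivity) h1 2
    linarith [sq_nonneg (k : ℝ)]
  have hmain : (2 * (m : ℝ) - k) * M - (1 - c / 8) * b ≤ -(c / 2) * M ^ 2 + 6 * M := by
    have h1 : (2 * (m : ℝ) - k) * M ≤ (2 * ((1 + β) * M) - k) * M := by gcongr
    have h2 : (2 * ((1 + β) * M) - k) * M - b ≤ -c * M ^ 2 + 6 * M := by
      rw [hx] at hb1 ⊢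
      have : (2 * ((1 + β) * M) - (1 + x) * M) * M - ((1 + β) ^ 2 * M ^ 2 - 6 * M -
          ((1 + x) * M) ^ 2 / 2) = (1 / 2 - β ^ 2 + x ^ 2 / 2) * M ^ 2 + 6 * M := by ring
      have h3 : (1 / 2 - β ^ 2 + x ^ 2 / 2) * M ^ 2 ≤ -c * M ^ 2 := by
        gcongr
        rw [hc]
        linarith
      linarith
    -- The loss c/8 in the probability uses up half of the gap cM².
    have h3 : c / 8 * b ≤ c / 8 * (4 * M ^ 2) := by gcongr
    linarith
  have e1 : (2 * (m : ℝ) - k) * ℓ + 3 * n / d - (1 - c / 8) * (b * d / n) =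
      ((2 * (m : ℝ) - k) * M - (1 - c / 8) * b) * (ℓ / M) + 3 * (M / ℓ) := by
    rw [mul_div_assoc b, hdn, mul_div_assoc 3, hnd]
    field_simp
    ring
  have e2 : 6 * ℓ - c / 4 * ℓ ^ 2 / d * n = (-(c / 2) * M ^ 2 + 6 * M) * (ℓ / M) +
      c / 4 * (ℓ * M) := by
    have : c / 4 * ℓ ^ 2 / d * n = c / 4 * ℓ * M := by
      rw [hMdef]
      ring
    rw [this]
    field_simp
    ring
  rw [e1, e2]
  -- The enumeration error takes half of the remaining gap; this is the assumption 12 ≤ cℓ².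
  have h4 : 3 * (M / ℓ) ≤ c / 4 * (ℓ * M) := by
    rw [mul_div_assoc', div_le_iff₀ hℓ]
    nlinarith
  gcongr

/-- If the probability that two given sets are independent is at most the first moment heuristic up
to a small loss in the exponent, then overlaps in the forbidden range are unlikely. -/
lemma tendsto_overlapEvent {β z c d C : ℝ} (hβ0 : 0 < β) (hβ1 : β < 1)
    (hc : c = β ^ 2 - 1 / 2 - z ^ 2 / 2) (hc0 : 0 < c) (hd : 1 < d)
    (hlog : 12 ≤ c * Real.log d ^ 2) {l : Filter ℕ} (hl : l ≤ atTop) (hC : 0 ≤ C)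
    (μ : ∀ n, Measure (SimpleGraph (Fin n)))
    (hμ : ∀ᶠ n in l, ∀ I J : Finset (Fin n), #I = ⌊density β d * n⌋₊ →
      #J = ⌊density β d * n⌋₊ → μ n (avoiding (insidePairs I J)) ≤ ENNReal.ofReal
        (C * (1 + n) * Real.exp (-((1 - c / 8) * (#(insidePairs I J) * d / n))))) :
    Tendsto (fun n => μ n (overlapEvent β z d n)) l (𝓝 0) := by
  have hd0 : 0 < d := by linarith
  have hℓ : 0 < Real.log d := Real.log_pos hd
  set γ := c / 4 * Real.log d ^ 2 / d with hγ
  have hγ0 : 0 < γ := by positivity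
  have hM : ∀ᶠ n : ℕ in l, 1 ≤ n * Real.log d / d := by
    refine hl ((tendsto_natCast_atTop_atTop.eventually_ge_atTop (d / Real.log d)).mono ?_)
    intro n hn
    rw [le_div_iff₀ hd0, one_mul]
    rwa [div_le_iff₀ hℓ] at hn
  -- The outer factor 1 + n counts the values of k; the inner one comes from `hμ`.
  have hbound : ∀ᶠ n in l, μ n (overlapEvent β z d n) ≤ ENNReal.ofReal
      ((1 + n) * (C * (1 + n) * Real.exp (6 * Real.log d - γ * n))) := by
    filter_upwards [hM, hμ] with n hM hμ
    set m := ⌊density β d * n⌋₊ with hm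
    classical
    have hsub : overlapEvent β z d n ⊆
        ⋃ k ∈ (range (n + 1)).filter (fun k => k ∈ forbidden z d n ∧ k ≤ m),
          ⋃ P ∈ pairsWith n m k, avoiding (insidePairs P.1 P.2) := by
      rintro G ⟨P, hP⟩
      simp only [Set.mem_iUnion] at hP
      obtain ⟨k, hk, h1, h2, h3⟩ := hP
      simp only [Set.mem_iUnion]
      have hkm : k ≤ m := by
        rw [← h3, hm, ← h1.card_eq]
        exact card_le_card inter_subset_left
      have hkn : k ≤ n := by
        rw [← h3]
        exact (card_le_univ _).trans (by simp)
      exact ⟨k, by simp [hk, hkm]; omega, P, by simp [pairsWith, h1.card_eq, h2.card_eq, h3, hm],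
        mem_avoiding_insidePairs h1.isIndepSet h2.isIndepSet⟩
    set X := C * (1 + n) * Real.exp (6 * Real.log d - γ * n) with hX
    have hX0 : 0 ≤ X := by positivity
    have hk : ∀ k ∈ (range (n + 1)).filter (fun k => k ∈ forbidden z d n ∧ k ≤ m),
        μ n (⋃ P ∈ pairsWith n m k, avoiding (insidePairs P.1 P.2)) ≤ ENNReal.ofReal X := by
      intro k hk
      obtain ⟨-, hk, hkm⟩ := mem_filter.1 hk
      -- There are at most Y pairs, each contributing at most X/Y.
      set Y := Real.exp ((2 * m - k) * Real.log d + 3 * n / d) with hY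
      have hP : ∀ P ∈ pairsWith n m k, μ n (avoiding (insidePairs P.1 P.2)) ≤
          ENNReal.ofReal (X / Y) := by
        intro P hP
        obtain ⟨-, h1, h2, h3⟩ := mem_filter.1 hP
        refine (hμ P.1 P.2 h1 h2).trans (ENNReal.ofReal_le_ofReal ?_)
        have := exponent_le hβ0 hβ1 hc hc0 hd hlog hm hM hk hkm
          (two_mul_card_insidePairs h1 h2 h3)
        rw [hX, hY, mul_div_assoc (C * (1 + (n : ℝ))), ← Real.exp_sub]
        gcongr
        linarith
      calc _ ≤ ∑ P ∈ pairsWith n m k, μ n (avoiding (insidePairs P.1 P.2)) :=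
            measure_biUnion_finset_le _ _
        _ ≤ ∑ P ∈ pairsWith n m k, ENNReal.ofReal (X / Y) := sum_le_sum hP
        _ = ENNReal.ofReal (#(pairsWith n m k) * (X / Y)) := by
            rw [sum_const, nsmul_eq_mul, ENNReal.ofReal_mul (by positivity), ENNReal.ofReal_natCast]
        _ ≤ ENNReal.ofReal X := by
            refine ENNReal.ofReal_le_ofReal ?_
            rw [mul_div_assoc', div_le_iff₀ (Real.exp_pos _), mul_comm]
            gcongr
            exact card_pairsWith_le_exp hd0 hkm
    calc _ ≤ _ := measure_mono hsub
      _ ≤ ∑ k ∈ (range (n + 1)).filter (fun k => k ∈ forbidden z d n ∧ k ≤ m),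
          μ n (⋃ P ∈ pairsWith n m k, avoiding (insidePairs P.1 P.2)) :=
          measure_biUnion_finset_le _ _
      _ ≤ ∑ k ∈ (range (n + 1)).filter (fun k => k ∈ forbidden z d n ∧ k ≤ m),
          ENNReal.ofReal X := sum_le_sum hk
      _ ≤ ∑ k ∈ range (n + 1), ENNReal.ofReal X :=
          sum_le_sum_of_subset (filter_subset _ _)
      _ = _ := by
          rw [sum_const, card_range, nsmul_eq_mul, ← ENNReal.ofReal_natCast,
            ← ENNReal.ofReal_mul (by positivity), hX]
          push_cast
          rw [add_comm (n : ℝ) 1]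
  have hlim : Tendsto (fun n : ℕ => ((1 + n : ℝ)) *
      (C * (1 + n) * Real.exp (6 * Real.log d - γ * n))) atTop (𝓝 0) := by
    have h1 : Tendsto (fun t : ℝ => t ^ 2 * Real.exp (-γ * t)) atTop (𝓝 0) := by
      have := tendsto_rpow_mul_exp_neg_mul_atTop_nhds_zero 2 γ hγ0
      simpa using this
    have h2 : Tendsto (fun n : ℕ => (1 + n : ℝ)) atTop atTop :=
      tendsto_atTop_add_const_left _ _ tendsto_natCast_atTop_atTop
    have h3 := (h1.comp h2).const_mul (C * Real.exp (6 * Real.log d + γ))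
    rw [mul_zero] at h3
    refine h3.congr fun n => ?_
    simp only [Function.comp_apply]
    rw [show 6 * Real.log d - γ * n = (6 * Real.log d + γ) + (-γ * (1 + n)) by ring,
      Real.exp_add (6 * Real.log d + γ)]
    ring
  have hlim' := (ENNReal.tendsto_ofReal hlim).mono_left hl
  rw [ENNReal.ofReal_zero] at hlim'
  exact tendsto_of_tendsto_of_tendsto_of_le_of_le' tendsto_const_nhds hlim'
    (Eventually.of_forall fun _ => zero_le) hbound

lemma tendsto_erdosRenyi {β z c d : ℝ} (hβ0 : 0 < β) (hβ1 : β < 1)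
    (hc : c = β ^ 2 - 1 / 2 - z ^ 2 / 2) (hc0 : 0 < c) (hd : 1 < d)
    (hlog : 12 ≤ c * Real.log d ^ 2) :
    Tendsto (fun n : ℕ => erdosRenyi n d (overlapEvent β z d n)) atTop (𝓝 0) := by
  refine tendsto_overlapEvent (C := 1) hβ0 hβ1 hc hc0 hd hlog le_rfl zero_le_one
    (fun n => erdosRenyi n d) ?_
  -- For n ≥ d the edge probability is not truncated.
  filter_upwards [tendsto_natCast_atTop_atTop.eventually_ge_atTop d] with n hn I J _ _
  refine (erdosRenyi_avoiding_le (by linarith) hn not_isDiag_of_mem_insidePairs).trans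
    (ENNReal.ofReal_le_ofReal ?_)
  have h0 : 0 ≤ #(insidePairs I J) * d / n := by positivity
  calc Real.exp (-(#(insidePairs I J) * d / n))
      ≤ Real.exp (-((1 - c / 8) * (#(insidePairs I J) * d / n))) := by
        gcongr
        nlinarith
    _ ≤ _ := by
        refine le_mul_of_one_le_left (Real.exp_pos _).le ?_
        have : (0 : ℝ) ≤ n := Nat.cast_nonneg _
        linarith

lemma tendsto_randomRegular {β z c : ℝ} {d : ℕ} (hβ0 : 0 < β) (hβ1 : β < 1)
    (hc : c = β ^ 2 - 1 / 2 - z ^ 2 / 2) (hc0 : 0 < c) (hd : 1 < (d : ℝ))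
    (hlog : 12 ≤ c * Real.log d ^ 2) (hd' : 16 * (Real.log d / d) ≤ c / 16) :
    Tendsto (fun n : ℕ => randomRegular n d (overlapEvent β z d n)) atTop (𝓝 0) := by
  have hcle : c ≤ 1 := by nlinarith
  have hd0 : 0 < d := by
    have : (0 : ℝ) < d := by linarith
    exact_mod_cast this
  refine tendsto_overlapEvent (C := Real.exp 2 * (1 + d)) hβ0 hβ1 hc hc0 hd hlog le_rfl
    (by positivity) (fun n => randomRegular n d) ?_
  filter_upwards [tendsto_natCast_atTop_atTop.eventually_ge_atTop ((3 * (d : ℝ) + 2) / (c / 16)),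
    eventually_gt_atTop 0] with n hn hn0 I J hI hJ
  have hn0' : (0 : ℝ) < n := by exact_mod_cast hn0
  have hmle : ((⌊density β d * n⌋₊ : ℕ) : ℝ) ≤ 2 * (Real.log d / d) * n := by
    have hℓ : 0 < Real.log d := Real.log_pos hd
    refine (Nat.floor_le (by rw [density]; positivity)).trans ?_
    rw [density, mul_div_assoc]
    gcongr
    linarith
  -- Here ε = c/8. One half absorbs 4#(I ∪ J) ≤ 8m ≤ 16(log d/d)n by `hd'`, the other absorbs 3d + 2
  -- for large n.
  have hW : 4 * (#(I ∪ J) : ℝ) + 3 * d + 2 ≤ c / 8 * Fintype.card (Fin n) := by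
    have h1 : (#(I ∪ J) : ℝ) ≤ #I + #J := by exact_mod_cast card_union_le I J
    rw [hI, hJ] at h1
    rw [Fintype.card_fin]
    rw [div_le_iff₀ (by positivity)] at hn
    have h2 := mul_le_mul_of_nonneg_right hd' hn0'.le
    linarith
  have h := card_regularWith_zero_le (d := d) (A := insidePairs I J)
    not_isDiag_of_mem_insidePairs mem_union_of_mem_insidePairs hd0
    (show (0 : ℝ) ≤ c / 8 by positivity) (by linarith) (by simpa using hn0) hW
  rw [Fintype.card_fin] at h
  have h0 : 0 ≤ (#(insidePairs I J) : ℝ) * d / n := by positivity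
  have h1 : 0 ≤ (1 - c / 8) * ((#(insidePairs I J) : ℝ) * d / n) := mul_nonneg (by linarith) h0
  refine (randomRegular_avoiding_le (by positivity) h).trans (ENNReal.ofReal_le_ofReal ?_)
  have hA : (#(insidePairs I J) : ℝ) ≤ n ^ 2 := by
    have h2 := two_mul_card_insidePairs hI hJ rfl
    have hIn : (⌊density β d * n⌋₊ : ℝ) ≤ n := by
      rw [← hI]
      exact_mod_cast (card_le_univ I).trans (by simp)
    have hkm : (#(I ∩ J) : ℝ) ≤ ⌊density β d * n⌋₊ := by
      rw [← hI]
      exact_mod_cast card_le_card inter_subset_left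
    have h3 : (⌊density β d * n⌋₊ : ℝ) ^ 2 ≤ (n : ℝ) ^ 2 := pow_le_pow_left₀ (by positivity) hIn 2
    have h4 : (0 : ℝ) ≤ #(I ∩ J) := by positivity
    nlinarith
  have h5 : (1 - c / 8) * ((#(insidePairs I J) : ℝ) * d / n) ≤ n * d := by
    calc (1 - c / 8) * ((#(insidePairs I J) : ℝ) * d / n)
        ≤ 1 * ((#(insidePairs I J) : ℝ) * d / n) := by
          gcongr
          linarith
      _ ≤ 1 * ((n : ℝ) ^ 2 * d / n) := by gcongr
      _ = n * d := by field_simp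
  -- Bounds the prefactor 1 + l of the switching estimate and accounts for the choice of `C`.
  have h6 : 1 + (1 - c / 8) * ((#(insidePairs I J) : ℝ) * d / n) ≤ (1 + d) * (1 + n) := by
    linarith
  rw [mul_assoc (Real.exp 2) (1 + (d : ℝ))]
  gcongr

end RandomGraphOverlap

theorem theorem2p6 (β z : ℝ) (hβ : 1 / √2 < β) (hβ' : β < 1)
    (hz : 0 < z) (hz' : z < √(2 * β ^ 2 - 1)) :
    (∀ᶠ d : ℝ in atTop,
      Tendsto (fun n : ℕ => RandomGraphOverlap.erdosRenyi n d
        (RandomGraphOverlap.overlapEvent β z d n)) atTop (𝓝 0)) ∧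
    (∀ᶠ d : ℕ in atTop,
      Tendsto (fun n : ℕ => RandomGraphOverlap.randomRegular n d
        (RandomGraphOverlap.overlapEvent β z d n))
        (atTop ⊓ 𝓟 {n : ℕ | Even (n * d)}) (𝓝 0)) := by
  have hβ0 : 0 < β := lt_trans (by positivity) hβ
  obtain ⟨c, hc⟩ : ∃ c : ℝ, c = β ^ 2 - 1 / 2 - z ^ 2 / 2 := ⟨_, rfl⟩
  have hc0 : 0 < c := by
    have := (Real.lt_sqrt hz.le).1 hz'
    rw [hc]
    linarith
  have hlog : ∀ᶠ d : ℝ in atTop, 12 ≤ c * Real.log d ^ 2 :=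
    (((tendsto_pow_atTop two_ne_zero).comp Real.tendsto_log_atTop).const_mul_atTop
      hc0).eventually_ge_atTop 12
  have hsmall : ∀ᶠ d : ℝ in atTop, 16 * (Real.log d / d) ≤ c / 16 := by
    have h := (Real.isLittleO_log_id_atTop.tendsto_div_nhds_zero).const_mul 16
    rw [mul_zero] at h
    exact h.eventually_le_const (by positivity)
  refine ⟨?_, ?_⟩
  · filter_upwards [hlog, eventually_gt_atTop 1] with d h1 h2
    exact RandomGraphOverlap.tendsto_erdosRenyi hβ0 hβ' hc hc0 h2 h1
  · filter_upwards [tendsto_natCast_atTop_atTop.eventually hlog,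
      tendsto_natCast_atTop_atTop.eventually hsmall,
      tendsto_natCast_atTop_atTop.eventually (eventually_gt_atTop (1 : ℝ))] with d h1 h2 h3
    -- The limit holds along all n: for odd nd there is no regular graph and the measure is zero.
    exact (RandomGraphOverlap.tendsto_randomRegular hβ0 hβ' hc hc0 h3 h1 h2).mono_left
      inf_le_left
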